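/- **Theorem.** Let $(R,\mathfrak m)$ be a Noetherian local ring and let $M$ be a finitely generated $R$-module of dimension $d\ge 1$ (the dimension of the support of $M$). Let $J=(x_1,\dots,x_d)$ be an ideal generated by a system of parameters for $M$, that is, $x_1,\dots,x_d\in\mathfrak m$ and the length $\lambda(M/JM)$ is finite. Then there are unique integers $e_0(J,M),\dots,e_d(J,M)$ such that for all sufficiently large $n$ the length $\lambda(M/J^nM)$ is finite and $$\lambda(M/J^nM)=\sum_{i=0}^{d}(-1)^i e_i(J,M)\binom{n+d-1-i}{d-i},$$ and the Chern number $e_1(J,M)$ satisfies $e_1(J,M)\le 0$. -/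

import Mathlib

open Polynomial Filter

/-- A sequence `x₁, …, x_d` in a local ring `R` is a system of parameters for the `R`-module `M`
if `d` is the dimension of `M`, all the `xᵢ` lie in the maximal ideal, and
`M / (x₁, …, x_d) M` has finite length. -/
structure IsSystemOfParameters {R : Type*} [CommRing R] [IsLocalRing R]
    (M : Type*) [AddCommGroup M] [Module R M] {d : ℕ} (x : Fin d → R) : Prop where
  dim_eq : Module.supportDim R M = d
  mem_maximalIdeal : ∀ i, x i ∈ IsLocalRing.maximalIdeal R
  length_ne_top :
    Module.length R (M ⧸ (Ideal.span (Set.range x) • ⊤ : Submodule R M)) ≠ ⊤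

/-- The Hilbert function `H_I(M, n) = λ(M / Iⁿ M)`. -/
noncomputable def hilbertFunction {R : Type*} [CommRing R] (I : Ideal R)
    (M : Type*) [AddCommGroup M] [Module R M] (n : ℕ) : ℕ∞ :=
  Module.length R (M ⧸ (I ^ n • ⊤ : Submodule R M))

/-- `P` is the Hilbert polynomial of `I` with respect to `M`: for all large `n`, the length
`λ(M / Iⁿ M)` is finite and equal to `P(n)`. -/
def IsHilbertPolynomial {R : Type*} [CommRing R] (I : Ideal R)
    (M : Type*) [AddCommGroup M] [Module R M] (P : ℚ[X]) : Prop :=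
  ∀ᶠ n : ℕ in atTop, ∃ l : ℕ, hilbertFunction I M n = l ∧ P.eval (n : ℚ) = l

/-- The polynomial `binom(x + k - 1, k) = x (x + 1) ⋯ (x + k - 1) / k!`. -/
noncomputable def risingBinomial (k : ℕ) : ℚ[X] :=
  C ((k.factorial : ℚ)⁻¹) * ascPochhammer ℚ k

/-- The integers `e₀, …, e_d` are the Hilbert coefficients of `I` with respect to the
`d`-dimensional module `M`: the Hilbert polynomial is
`∑ᵢ (-1)ⁱ eᵢ binom(x + d - i - 1, d - i)`. -/
def AreHilbertCoefficients {R : Type*} [CommRing R] (I : Ideal R)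
    (M : Type*) [AddCommGroup M] [Module R M] {d : ℕ} (e : Fin (d + 1) → ℤ) : Prop :=
  IsHilbertPolynomial I M
    (∑ i : Fin (d + 1), C ((-1 : ℚ) ^ (i : ℕ) * (e i : ℚ)) * risingBinomial (d - (i : ℕ)))

/-!
Let `J = (x₁, …, x_d)`. The monomials of degree `< n` in the `xᵢ`, in graded lexicographic order,
filter `M / JⁿM`; the quotients are `M / C(a)`, where the colon submodule `C(a)` contains `JM` and
grows under divisibility of monomials. So `λ(M / JⁿM)` is the sum over the simplex `|a| < n` of an
antitone function `l : ℕᵈ → ℕ`. By Dickson's lemma its `d`-th difference in `n` is eventually the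
constant `min l`, so it is eventually a polynomial with leading term `min l * binom(n + d - 1, d)`.
Since `l ≥ min l`, what remains after removing this term is nonnegative, and the coefficient of
`binom(n + d - 2, d - 1)` in it is `-e₁`.
-/

section SimplexSum

variable {σ A : Type*} [Finite σ] [AddCommMonoid A]

/-- The sum of the values of a function on the lattice points `a` of the simplex `|a| < n`. -/
noncomputable def simplexSum (l : (σ →₀ ℕ) → A) (n : ℕ) : A :=
  ∑ a ∈ (Finsupp.finite_of_degree_lt n).toFinset, l a

theorem simplexSum_zero (l : (σ →₀ ℕ) → A) : simplexSum l 0 = 0 := by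
  simp [simplexSum]

theorem natCast_simplexSum {S : Type*} [AddCommMonoidWithOne S] (l : (σ →₀ ℕ) → ℕ) (n : ℕ) :
    ((simplexSum l n : ℕ) : S) = simplexSum (fun a => (l a : S)) n :=
  Nat.cast_sum _ _

theorem simplexSum_succ_of_isEmpty [IsEmpty σ] (l : (σ →₀ ℕ) → A) (n : ℕ) :
    simplexSum l (n + 1) = l 0 := by
  have simplex_eq : (Finsupp.finite_of_degree_lt (σ := σ) (n + 1)).toFinset = {0} := by
    ext a
    simp [Subsingleton.elim a 0]
  rw [simplexSum, simplex_eq, Finset.sum_singleton]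

theorem simplexSum_succ {d : ℕ} (l : (Fin (d + 1) →₀ ℕ) → A) (n : ℕ) :
    simplexSum l (n + 1) =
      simplexSum (fun a => l (a + Finsupp.single 0 1)) n +
        simplexSum (fun a => l (a.cons 0)) (n + 1) := by
  have degree_cons_zero (a : Fin d →₀ ℕ) : (a.cons 0).degree = a.degree := by
    simp [Finsupp.degree_eq_sum, Fin.sum_univ_succ]
  have cons_zero_tail {a : Fin (d + 1) →₀ ℕ} (ha : a 0 = 0) : a.tail.cons 0 = a := by
    rw [← ha, Finsupp.cons_tail]
  have sub_add_single {a : Fin (d + 1) →₀ ℕ} (ha : a 0 ≠ 0) :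
      a - Finsupp.single 0 1 + Finsupp.single 0 1 = a :=
    tsub_add_cancel_of_le (by simpa [Nat.one_le_iff_ne_zero] using ha)
  rw [simplexSum, ← Finset.sum_filter_not_add_sum_filter _ (fun a => a 0 = 0)]
  congr 1
  · refine Finset.sum_nbij' (· - Finsupp.single 0 1) (· + Finsupp.single 0 1) ?_ ?_ ?_ ?_ ?_
    · intro a ha
      simp only [Finset.mem_filter, Set.Finite.mem_toFinset, Set.mem_ofPred_eq] at ha ⊢
      rw [← sub_add_single ha.2, map_add, Finsupp.degree_single] at ha
      exact Nat.succ_lt_succ_iff.mp ha.1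
    · intro a ha
      simpa using ha
    · intro a ha
      exact sub_add_single (Finset.mem_filter.mp ha).2
    · exact fun a _ => add_tsub_cancel_right a _
    · intro a ha
      rw [sub_add_single (Finset.mem_filter.mp ha).2]
  · refine Finset.sum_nbij' Finsupp.tail (Finsupp.cons 0) ?_ ?_ ?_ ?_ ?_
    · intro a ha
      simp only [Finset.mem_filter, Set.Finite.mem_toFinset, Set.mem_ofPred_eq] at ha ⊢
      rw [← degree_cons_zero, cons_zero_tail ha.2]
      exact ha.1
    · intro a ha
      simpa [degree_cons_zero] using ha
    · exact fun a ha => cons_zero_tail (Finset.mem_filter.mp ha).2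
    · exact fun a _ => Finsupp.tail_cons 0 a
    · intro a ha
      rw [cons_zero_tail (Finset.mem_filter.mp ha).2]

theorem simplexSum_one_succ (d n : ℕ) :
    simplexSum (fun _ : Fin d →₀ ℕ => 1) (n + 1) = (n + 1).multichoose d := by
  induction d generalizing n with
  | zero => rw [simplexSum_succ_of_isEmpty, Nat.multichoose_zero_right]
  | succ d ihd =>
    induction n with
    | zero => rw [simplexSum_succ, simplexSum_zero, ihd, zero_add, Nat.multichoose_one,
        Nat.multichoose_one]
    | succ n ihn => rw [simplexSum_succ, ihn, ihd, Nat.multichoose_succ_succ (n + 1), add_comm]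

theorem iInf_mul_multichoose_le_simplexSum {d : ℕ} (l : (Fin d →₀ ℕ) → ℕ) (n : ℕ) :
    (⨅ a, l a) * (n + 1).multichoose d ≤ simplexSum l (n + 1) := by
  rw [← simplexSum_one_succ, simplexSum, Finset.mul_sum]
  simp only [mul_one]
  exact Finset.sum_le_sum fun a _ => ciInf_le (OrderBot.bddBelow _) a

end SimplexSum

section Antitone

theorem wellFoundedLT_antitone (α β : Type*) [Preorder α] [WellQuasiOrderedLE α] [Preorder β]
    [WellQuasiOrderedLE β] : WellFoundedLT {l : α → β // Antitone l} := by
  refine ⟨RelEmbedding.wellFounded_iff_isEmpty.mpr ⟨fun l => ?_⟩⟩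
  have l_lt (n : ℕ) : (l (n + 1)).1 < (l n).1 := l.map_rel_iff.mpr n.lt_succ_self
  have l_anti : Antitone fun n => (l n).1 := antitone_nat_of_succ_le fun n => (l_lt n).le
  -- A good pair among the points where `l n` drops, taken with the value after the drop,
  -- contradicts the later of the two drops.
  choose a drop using fun n => (Pi.lt_def.mp (l_lt n)).2
  obtain ⟨m, n, hmn, hval, ha⟩ := wellQuasiOrdered_le fun n => ((l (n + 1)).1 (a n), a n)
  refine lt_irrefl ((l (n + 1)).1 (a n)) ?_
  calc (l (n + 1)).1 (a n) < (l n).1 (a n) := drop n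
    _ ≤ (l (m + 1)).1 (a n) := l_anti hmn (a n)
    _ ≤ (l (m + 1)).1 (a m) := (l (m + 1)).2 ha
    _ ≤ (l (n + 1)).1 (a n) := hval

theorem iInf_comp_add_right {α β : Type*} [Nonempty α] [Add α] [Preorder α]
    [CanonicallyOrderedAdd α] [ConditionallyCompleteLinearOrderBot β] {l : α → β}
    (hl : Antitone l) (c : α) :
    ⨅ a, l (a + c) = ⨅ a, l a :=
  le_antisymm (ciInf_mono (OrderBot.bddBelow _) fun _ => hl le_self_add)
    (le_ciInf fun a => ciInf_le (OrderBot.bddBelow _) (a + c))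

theorem iInf_cons_zero {d : ℕ} {β : Type*} [ConditionallyCompleteLinearOrderBot β]
    {l : (Fin (d + 1) →₀ ℕ) → β} (hl : ∀ a, l (a + Finsupp.single 0 1) = l a) :
    ⨅ a : Fin d →₀ ℕ, l (a.cons 0) = ⨅ a, l a := by
  have l_cons (k : ℕ) (a : Fin d →₀ ℕ) : l (a.cons k) = l (a.cons 0) := by
    induction k with
    | zero => rfl
    | succ k ih =>
      have cons_succ_eq : a.cons (k + 1) = a.cons k + Finsupp.single 0 1 := by
        ext i
        cases i using Fin.cases <;> simp
      rw [cons_succ_eq, hl, ih]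
  refine le_antisymm (le_ciInf fun a => ?_)
    (le_ciInf fun a => ciInf_le (OrderBot.bddBelow _) (a.cons 0))
  rw [← Finsupp.cons_tail a, l_cons]
  exact ciInf_le (OrderBot.bddBelow _) a.tail

open scoped fwdDiff

theorem fwdDiff_iter_simplexSum_succ {d : ℕ} {G : Type*} [AddCommGroup G]
    (l : (Fin (d + 1) →₀ ℕ) → G) (k n : ℕ) :
    Δ_[1] ^[k] (simplexSum l) (n + 1) =
      Δ_[1] ^[k] (simplexSum fun a => l (a + Finsupp.single 0 1)) n +
        Δ_[1] ^[k] (simplexSum fun a => l (a.cons 0)) (n + 1) := by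
  rw [← fwdDiff_iter_comp_add, ← fwdDiff_iter_comp_add, ← Pi.add_apply, ← fwdDiff_iter_add]
  simp only [simplexSum_succ]
  rfl

theorem eventually_fwdDiff_iter_simplexSum {d : ℕ} {l : (Fin d →₀ ℕ) → ℕ} (hl : Antitone l) :
    ∀ᶠ n in atTop, Δ_[1] ^[d] (simplexSum fun a => (l a : ℤ)) n = (⨅ a, l a : ℕ) := by
  induction d with
  | zero =>
    filter_upwards [eventually_ge_atTop 1] with n hn
    obtain ⟨n, rfl⟩ := Nat.exists_eq_add_of_le' hn
    simp [simplexSum_succ_of_isEmpty, ciInf_unique, Finsupp.default_eq_zero]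
  | succ d ihd =>
    have := wellFoundedLT_antitone (Fin (d + 1) →₀ ℕ) ℕ
    lift l to {l : (Fin (d + 1) →₀ ℕ) → ℕ // Antitone l} using hl
    induction l using WellFoundedLT.induction with
    | ind l ihl =>
    obtain ⟨l, hl⟩ := l
    have face_antitone : Antitone fun a : Fin d →₀ ℕ => l (a.cons 0) := fun a b hab =>
      hl (Fin.cases le_rfl hab)
    have shift_antitone : Antitone fun a => l (a + Finsupp.single 0 1) := fun a b hab =>
      hl (add_le_add_left hab _)
    have shift_le : (fun a => l (a + Finsupp.single 0 1)) ≤ l := fun a => hl le_self_add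
    have face_eventually := (tendsto_add_atTop_nat 1).eventually (ihd face_antitone)
    obtain shift_eq | shift_lt := shift_le.eq_or_lt
    · filter_upwards [face_eventually] with n face_eq
      have succ_eq := fwdDiff_iter_simplexSum_succ (fun a => (l a : ℤ)) d n
      simp only [congrFun shift_eq, face_eq, iInf_cons_zero (congrFun shift_eq)] at succ_eq
      rw [Function.iterate_succ_apply', fwdDiff, succ_eq, add_sub_cancel_left]
    · have shift_eventually := ihl ⟨_, shift_antitone⟩ shift_lt
      rw [← map_add_atTop_eq_nat 1, eventually_map]
      filter_upwards [shift_eventually, face_eventually,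
        (tendsto_add_atTop_nat 1).eventually face_eventually] with n shift_eq face_eq face_succ_eq
      rw [fwdDiff_iter_simplexSum_succ, shift_eq, iInf_comp_add_right hl,
        Function.iterate_succ_apply' _ _ (simplexSum _), fwdDiff, face_eq, face_succ_eq, sub_self,
        add_zero]

end Antitone

section PolynomialGrowth

open scoped fwdDiff

theorem exists_eventually_eq_of_eventually_fwdDiff_eq_zero {G : Type*} [AddCommGroup G]
    {f : ℕ → G} (hf : ∀ᶠ n in atTop, Δ_[1] f n = 0) : ∃ c, ∀ᶠ n in atTop, f n = c := by
  obtain ⟨N, hN⟩ := eventually_atTop.mp hf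
  refine ⟨f N, eventually_atTop.mpr ⟨N, fun n hn => ?_⟩⟩
  induction n, hn using Nat.le_induction with
  | base => rfl
  | succ n hn ih => rw [← ih, ← sub_eq_zero]; exact hN n hn

theorem exists_eventually_eq_sum_multichoose {S : Type*} [Ring S] {d : ℕ} {f : ℕ → S} {m : S}
    (hf : ∀ᶠ n in atTop, Δ_[1] ^[d] f n = m) :
    ∃ c : ℕ → S, c d = m ∧
      ∀ᶠ n in atTop, f n = ∑ k ∈ Finset.range (d + 1), c k * n.multichoose k := by
  induction d generalizing f with
  | zero => exact ⟨fun _ => m, rfl, by simpa using hf⟩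
  | succ d ih =>
    -- `Δ (multichoose · (k + 1))` at `n` is `(n + 1).multichoose k`, so the backward difference
    -- of `f` has the coefficients of `f`, moved down by one.
    have backward_diff : ∀ᶠ n in atTop, Δ_[1] ^[d] (fun n => f n - f (n - 1)) n = m := by
      rw [← map_add_atTop_eq_nat 1, eventually_map]
      filter_upwards [hf] with n hn
      rw [← hn, ← fwdDiff_iter_comp_add]
      rfl
    obtain ⟨c, hcd, hc⟩ := ih backward_diff
    obtain ⟨c₀, hc₀⟩ := exists_eventually_eq_of_eventually_fwdDiff_eq_zero
      (f := fun n => f n - ∑ k ∈ Finset.range (d + 1), c k * n.multichoose (k + 1)) (by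
        filter_upwards [(tendsto_add_atTop_nat 1).eventually hc] with n hn
        rw [Nat.add_sub_cancel] at hn
        simp only [fwdDiff, Nat.multichoose_succ_succ, Nat.cast_add, mul_add,
          Finset.sum_add_distrib, ← hn]
        abel)
    refine ⟨fun k => Nat.casesOn k c₀ c, hcd, ?_⟩
    filter_upwards [hc₀] with n hn
    rw [Finset.sum_range_succ', Nat.multichoose_zero_right, Nat.cast_one, mul_one, ← hn]
    exact (add_sub_cancel _ _).symm

theorem degree_risingBinomial (k : ℕ) : (risingBinomial k).degree = k := by
  rw [risingBinomial, degree_C_mul (by positivity),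
    degree_eq_natDegree (monic_ascPochhammer ℚ k).ne_zero, ascPochhammer_natDegree]

theorem linearIndependent_risingBinomial : LinearIndependent ℚ risingBinomial :=
  (⟨risingBinomial, degree_risingBinomial⟩ : Polynomial.Sequence ℚ).linearIndependent

theorem risingBinomial_eval_natCast (k n : ℕ) :
    (risingBinomial k).eval (n : ℚ) = (n.multichoose k : ℚ) := by
  rw [risingBinomial, eval_mul, eval_C, ← ascPochhammer_eval_cast,
    ascPochhammer_nat_eq_ascFactorial, Nat.ascFactorial_eq_factorial_mul_choose',
    Nat.multichoose_eq, Nat.cast_mul, inv_mul_cancel_left₀ (by positivity)]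

theorem tendsto_multichoose_div_multichoose_zero {j k : ℕ} (hjk : j < k) :
    Tendsto (fun n : ℕ => (n.multichoose j / n.multichoose k : ℚ)) atTop (nhds 0) := by
  simp only [← risingBinomial_eval_natCast]
  refine (div_tendsto_atTop_zero_of_degree_lt _ _ ?_).comp tendsto_natCast_atTop_atTop
  simpa only [degree_risingBinomial, Nat.cast_lt] using hjk

theorem nonneg_of_eventually_sum_multichoose_nonneg {d : ℕ} {c : ℕ → ℤ}
    (h : ∀ᶠ n : ℕ in atTop, 0 ≤ ∑ k ∈ Finset.range (d + 1), c k * n.multichoose k) :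
    0 ≤ c d := by
  have quotient_tendsto : Tendsto
      (fun n : ℕ => ∑ k ∈ Finset.range d, (c k : ℚ) * (n.multichoose k / n.multichoose d) + c d)
      atTop (nhds (c d)) := by
    simpa using (tendsto_finsetSum (Finset.range d) fun k hk =>
      (tendsto_multichoose_div_multichoose_zero (Finset.mem_range.mp hk)).const_mul
        (c k : ℚ)).add_const (c d : ℚ)
  suffices 0 ≤ (c d : ℚ) by exact_mod_cast this
  refine ge_of_tendsto quotient_tendsto ?_
  filter_upwards [h, eventually_ge_atTop 1] with n sum_nonneg one_le
  have multichoose_pos : (0 : ℚ) < n.multichoose d := by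
    rw [Nat.multichoose_eq]
    exact_mod_cast Nat.choose_pos (by omega)
  have quotient_nonneg :
      0 ≤ (∑ k ∈ Finset.range (d + 1), (c k : ℚ) * n.multichoose k) / n.multichoose d :=
    div_nonneg (by exact_mod_cast sum_nonneg) multichoose_pos.le
  rw [Finset.sum_range_succ, add_div, Finset.sum_div,
    mul_div_cancel_right₀ _ multichoose_pos.ne'] at quotient_nonneg
  simpa only [mul_div_assoc] using quotient_nonneg

theorem exists_eventually_simplexSum_eq_sum_multichoose {d : ℕ} {l : (Fin (d + 1) →₀ ℕ) → ℕ}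
    (hl : Antitone l) :
    ∃ c : ℕ → ℤ, 0 ≤ c d ∧ ∀ᶠ n in atTop,
      ((simplexSum l n : ℕ) : ℤ) = ∑ k ∈ Finset.range (d + 2), c k * n.multichoose k := by
  obtain ⟨c, c_succ, hc⟩ :=
    exists_eventually_eq_sum_multichoose (eventually_fwdDiff_iter_simplexSum hl)
  simp only [← natCast_simplexSum] at hc
  refine ⟨c, nonneg_of_eventually_sum_multichoose_nonneg ?_, hc⟩
  filter_upwards [hc, eventually_ge_atTop 1] with n hn one_le
  obtain ⟨n, rfl⟩ := Nat.exists_eq_add_of_le' one_le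
  rw [Finset.sum_range_succ, c_succ] at hn
  have lower_bound : ((⨅ a, l a : ℕ) * (n + 1).multichoose (d + 1) : ℤ) ≤ simplexSum l (n + 1) :=
    by exact_mod_cast iInf_mul_multichoose_le_simplexSum l n
  linarith

end PolynomialGrowth

section Length

variable {R M P : Type*} [Ring R] [AddCommGroup M] [Module R M] [AddCommGroup P] [Module R P]

theorem length_quotient_eq_length_quotient_comap_add (f : P →ₗ[R] M) (N : Submodule R M) :
    Module.length R (M ⧸ N) =
      Module.length R (P ⧸ N.comap f) + Module.length R (M ⧸ N ⊔ LinearMap.range f) := by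
  refine Module.length_eq_add_of_exact (Submodule.mapQ (N.comap f) N f le_rfl)
    (Submodule.factor (le_sup_left : N ≤ N ⊔ LinearMap.range f)) ?_
    (Submodule.factor_surjective _) ?_
  · rw [← LinearMap.ker_eq_bot, Submodule.ker_mapQ, Submodule.mkQ_map_self]
  · rw [LinearMap.exact_iff, Submodule.factor, Submodule.ker_mapQ, Submodule.range_mapQ]
    simp

theorem length_quotient_anti {N N' : Submodule R M} (h : N ≤ N') :
    Module.length R (M ⧸ N') ≤ Module.length R (M ⧸ N) :=
  Module.length_le_of_surjective _ (Submodule.factor_surjective h)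

end Length

section SuccessiveColon

variable {R ι : Type*} [CommRing R] [LinearOrder ι] (M : Type*) [AddCommGroup M] [Module R M]
  (r : ι → R)

/-- For a family `r` of ring elements indexed by a linear order, the colon submodule
`(r b : b > a) M :_M r a`. The quotients of `M` by these submodules are the successive quotients of
the filtration of `M` by the submodules `(r b : b ≥ a) M`. -/
def successiveColon (a : ι) : Submodule R M :=
  (Ideal.span (r '' Set.Ioi a) • ⊤ : Submodule R M).comap (LinearMap.lsmul R M (r a))

variable {M r}

theorem mem_successiveColon {a : ι} {m : M} :
    m ∈ successiveColon M r a ↔ r a • m ∈ (Ideal.span (r '' Set.Ioi a) • ⊤ : Submodule R M) :=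
  Iff.rfl

variable (M r)

theorem length_quotient_eq_length_quotient_successiveColon_add (a : ι) :
    Module.length R (M ⧸ (Ideal.span (r '' Set.Ioi a) • ⊤ : Submodule R M)) =
      Module.length R (M ⧸ successiveColon M r a) +
        Module.length R (M ⧸ (Ideal.span (r '' Set.Ici a) • ⊤ : Submodule R M)) := by
  have range_eq :
      LinearMap.range (LinearMap.lsmul R M (r a)) = (Ideal.span {r a} • ⊤ : Submodule R M) := by
    rw [Submodule.ideal_span_singleton_smul]
    exact (Submodule.map_top _).symm
  rw [length_quotient_eq_length_quotient_comap_add (LinearMap.lsmul R M (r a)), range_eq,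
    ← Submodule.sup_smul, ← Ideal.span_union, Set.union_singleton, ← Set.image_insert_eq,
    Set.Ioi_insert]
  rfl

theorem length_quotient_eq_sum_successiveColon {s : Finset ι} (hs : IsLowerSet (s : Set ι)) :
    Module.length R (M ⧸ (Ideal.span (r '' (s : Set ι)ᶜ) • ⊤ : Submodule R M)) =
      ∑ a ∈ s, Module.length R (M ⧸ successiveColon M r a) +
        Module.length R (M ⧸ (Ideal.span (Set.range r) • ⊤ : Submodule R M)) := by
  induction s using Finset.induction_on_max with
  | empty => rw [Finset.coe_empty, Set.compl_empty, Set.image_univ, Finset.sum_empty, zero_add]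
  | insert a s lt_a ih =>
    have a_notMem : a ∉ s := fun ha => (lt_a a ha).false
    have s_eq_Iio : (s : Set ι) = Set.Iio a := Set.ext fun b =>
      ⟨lt_a b, fun hb => Finset.mem_of_mem_insert_of_ne (hs hb.le (by simp)) hb.ne⟩
    have compl_insert : ((insert a s : Finset ι) : Set ι)ᶜ = Set.Ioi a := by
      rw [Finset.coe_insert, s_eq_Iio, Set.Iio_insert, Set.compl_Iic]
    rw [s_eq_Iio, Set.compl_Iio] at ih
    rw [compl_insert, Finset.sum_insert a_notMem, add_assoc,
      ← ih (s_eq_Iio ▸ isLowerSet_Iio a),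
      length_quotient_eq_length_quotient_successiveColon_add]

end SuccessiveColon

section Monomial

open scoped Pointwise

variable {R σ : Type*} [CommRing R] (x : σ → R)

/-- The monomial `∏ i, x i ^ a i`. The exponents carry the graded lexicographic order, since the
filtration by monomials requires a linear order compatible with addition, in which the
exponents of total degree less than `n` form a lower set. -/
def monomialAt (a : DegLex (σ →₀ ℕ)) : R :=
  (ofDegLex a).prod fun i k => x i ^ k

theorem monomialAt_zero : monomialAt x 0 = 1 :=
  Finsupp.prod_zero_index

theorem monomialAt_add (a b : DegLex (σ →₀ ℕ)) :
    monomialAt x (a + b) = monomialAt x a * monomialAt x b :=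
  Finsupp.prod_add_index' (fun i => pow_zero (x i)) fun i => pow_add (x i)

theorem monomialAt_single (i : σ) : monomialAt x (toDegLex (Finsupp.single i 1)) = x i := by
  simp [monomialAt]

theorem span_range_pow_eq_span_monomialAt (n : ℕ) :
    Ideal.span (Set.range x) ^ n =
      Ideal.span (monomialAt x '' {a | (ofDegLex a).degree = n}) := by
  rw [Ideal.span, Submodule.span_pow, ← Set.image_univ, Finsupp.image_pow_eq_finsuppProd_image]
  simp only [Set.subset_univ, and_true]
  rfl

theorem span_monomialAt_le_degree (n : ℕ) :
    Ideal.span (monomialAt x '' {a | n ≤ (ofDegLex a).degree}) =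
      Ideal.span (Set.range x) ^ n := by
  apply le_antisymm
  · rw [Ideal.span_le]
    rintro _ ⟨a, ha, rfl⟩
    refine Ideal.pow_le_pow_right ha ?_
    rw [span_range_pow_eq_span_monomialAt]
    exact Ideal.subset_span ⟨a, rfl, rfl⟩
  · rw [span_range_pow_eq_span_monomialAt]
    exact Ideal.span_mono (Set.image_mono fun a ha => ha.ge)

variable [LinearOrder σ] (M : Type*) [AddCommGroup M] [Module R M]

theorem span_monomialAt_mul_span_monomialAt_Ioi_le (a b : DegLex (σ →₀ ℕ)) :
    Ideal.span {monomialAt x b} * Ideal.span (monomialAt x '' Set.Ioi a) ≤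
      Ideal.span (monomialAt x '' Set.Ioi (b + a)) := by
  rw [Ideal.span_mul_span', Ideal.span_le]
  rintro _ ⟨_, rfl, _, ⟨c, hc, rfl⟩, rfl⟩
  exact Ideal.subset_span ⟨b + c, add_lt_add_right hc b, monomialAt_add x b c⟩

theorem successiveColon_monomialAt_mono {a b : DegLex (σ →₀ ℕ)}
    (hab : ofDegLex a ≤ ofDegLex b) :
    successiveColon M (monomialAt x) a ≤ successiveColon M (monomialAt x) b := by
  obtain ⟨c, rfl⟩ : ∃ c, b = c + a :=
    (exists_add_of_le hab).imp fun c hc => hc.trans (add_comm _ _)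
  intro m hm
  rw [mem_successiveColon, monomialAt_add, mul_smul]
  refine Submodule.smul_mono_left (span_monomialAt_mul_span_monomialAt_Ioi_le x a c) ?_
  rw [mul_smul]
  exact Submodule.smul_mem_smul (Ideal.mem_span_singleton_self _) hm

theorem span_range_smul_top_le_successiveColon_zero :
    (Ideal.span (Set.range x) • ⊤ : Submodule R M) ≤ successiveColon M (monomialAt x) 0 := by
  have span_le : Ideal.span (Set.range x) ≤ Ideal.span (monomialAt x '' Set.Ioi 0) := by
    refine Ideal.span_mono ?_
    rintro _ ⟨i, rfl⟩
    have single_pos : (⊥ : DegLex (σ →₀ ℕ)) < toDegLex (Finsupp.single i 1) :=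
      Ne.bot_lt (Finsupp.single_ne_zero.mpr one_ne_zero)
    exact ⟨toDegLex (Finsupp.single i 1), single_pos, monomialAt_single x i⟩
  intro m hm
  rw [mem_successiveColon, monomialAt_zero, one_smul]
  exact Submodule.smul_mono_left span_le hm

variable [Finite σ]

theorem hilbertFunction_eq_simplexSum (n : ℕ) :
    hilbertFunction (Ideal.span (Set.range x)) M n =
      simplexSum
        (fun a => Module.length R (M ⧸ successiveColon M (monomialAt x) (toDegLex a))) n := by
  let s : Finset (DegLex (σ →₀ ℕ)) :=
    (Finsupp.finite_of_degree_lt n).toFinset.map toDegLex.toEmbedding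
  have mem_s (a) : a ∈ s ↔ (ofDegLex a).degree < n := by simp [s]
  have isLowerSet_s : IsLowerSet (s : Set (DegLex (σ →₀ ℕ))) := fun a b hba ha =>
    (mem_s b).mpr ((Finsupp.DegLex.monotone_degree hba).trans_lt ((mem_s a).mp ha))
  have compl_s : (s : Set (DegLex (σ →₀ ℕ)))ᶜ = {a | n ≤ (ofDegLex a).degree} :=
    Set.ext fun a => (mem_s a).not.trans not_lt
  have span_range_monomialAt : Ideal.span (Set.range (monomialAt x)) = ⊤ :=
    Ideal.eq_top_of_isUnit_mem _ (Ideal.subset_span ⟨0, monomialAt_zero x⟩) isUnit_one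
  have length_eq := length_quotient_eq_sum_successiveColon M (monomialAt x) isLowerSet_s
  rwa [compl_s, span_monomialAt_le_degree, span_range_monomialAt, Submodule.top_smul,
    Module.length_eq_zero (M := M ⧸ ⊤), add_zero, Finset.sum_map] at length_eq

variable {x M}

theorem exists_antitone_hilbertFunction_eq_simplexSum
    (hx : Module.length R (M ⧸ (Ideal.span (Set.range x) • ⊤ : Submodule R M)) ≠ ⊤) :
    ∃ l : (σ →₀ ℕ) → ℕ, Antitone l ∧
      ∀ n, hilbertFunction (Ideal.span (Set.range x)) M n = simplexSum l n := by
  have length_ne_top (a : DegLex (σ →₀ ℕ)) :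
      Module.length R (M ⧸ successiveColon M (monomialAt x) a) ≠ ⊤ := by
    refine ne_top_of_le_ne_top hx (length_quotient_anti ?_)
    exact (span_range_smul_top_le_successiveColon_zero x M).trans
      (successiveColon_monomialAt_mono x M (zero_le : 0 ≤ ofDegLex a))
  refine ⟨fun a => (Module.length R (M ⧸ successiveColon M (monomialAt x) (toDegLex a))).toNat,
    fun a b hab => ?_, fun n => ?_⟩
  · exact ENat.toNat_le_toNat (length_quotient_anti (successiveColon_monomialAt_mono x M hab))
      (length_ne_top _)
  · rw [hilbertFunction_eq_simplexSum, simplexSum, simplexSum, Nat.cast_sum]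
    exact Finset.sum_congr rfl fun a _ => (ENat.natCast_toNat (length_ne_top _)).symm

end Monomial

section HilbertCoefficients

variable {R M : Type*} [CommRing R] [AddCommGroup M] [Module R M] {I : Ideal R}

theorem IsHilbertPolynomial.unique {P Q : ℚ[X]} (hP : IsHilbertPolynomial I M P)
    (hQ : IsHilbertPolynomial I M Q) : P = Q := by
  have eval_eq : ∀ᶠ n : ℕ in atTop, P.eval (n : ℚ) = Q.eval (n : ℚ) := by
    filter_upwards [hP, hQ] with n ⟨l, hl, hPl⟩ ⟨l', hl', hQl'⟩
    have : l = l' := by exact_mod_cast hl.symm.trans hl'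
    rw [hPl, hQl', this]
  refine eq_of_infinite_eval_eq P Q (Set.Infinite.mono ?_
    ((Nat.frequently_atTop_iff_infinite.mp eval_eq.frequently).image Nat.cast_injective.injOn))
  rintro _ ⟨n, hn, rfl⟩
  exact hn

theorem AreHilbertCoefficients.unique {d : ℕ} {e e' : Fin (d + 1) → ℤ}
    (he : AreHilbertCoefficients I M e) (he' : AreHilbertCoefficients I M e') : e = e' := by
  have sub_injective : Function.Injective fun i : Fin (d + 1) => d - (i : ℕ) := fun i j hij =>
    Fin.ext (by dsimp only at hij; omega)
  have coeff_eq := (linearIndependent_risingBinomial.comp _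
    sub_injective).fintypeLinearCombination_injective
    (a₁ := fun i => (-1) ^ (i : ℕ) * (e i : ℚ)) (a₂ := fun i => (-1) ^ (i : ℕ) * (e' i : ℚ)) (by
      simpa only [Fintype.linearCombination_apply, Function.comp_apply, smul_eq_C_mul] using
        IsHilbertPolynomial.unique he he')
  funext i
  simpa using congrFun coeff_eq i

theorem areHilbertCoefficients_of_eventually_eq_sum_multichoose {d : ℕ} {f : ℕ → ℕ}
    (hf : ∀ n, hilbertFunction I M n = f n) {c : ℕ → ℤ}
    (hc : ∀ᶠ n in atTop, (f n : ℤ) = ∑ k ∈ Finset.range (d + 1), c k * n.multichoose k) :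
    AreHilbertCoefficients I M fun i : Fin (d + 1) => (-1) ^ (i : ℕ) * c (d - i) := by
  filter_upwards [hc] with n hn
  refine ⟨f n, hf n, ?_⟩
  have neg_one_pow_mul_self (i : ℕ) : (-1 : ℚ) ^ i * (-1) ^ i = 1 := by
    rw [← mul_pow, neg_one_mul, neg_neg, one_pow]
  calc _ = ∑ i : Fin (d + 1), (c (d - i) : ℚ) * n.multichoose (d - i) := by
        simp only [eval_finsetSum, eval_mul, eval_C, risingBinomial_eval_natCast, Int.cast_mul,
          Int.cast_pow, Int.cast_neg, Int.cast_one, ← mul_assoc, neg_one_pow_mul_self, one_mul]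
    _ = ∑ k ∈ Finset.range (d + 1), (c k : ℚ) * n.multichoose k := by
        rw [Fin.sum_univ_eq_sum_range fun i => (c (d - i) : ℚ) * n.multichoose (d - i)]
        exact Finset.sum_range_reflect (fun k => (c k : ℚ) * n.multichoose k) (d + 1)
    _ = f n := by exact_mod_cast hn.symm

end HilbertCoefficients

theorem mainTheorem3_general {R : Type*} [CommRing R] {M : Type*} [AddCommGroup M] [Module R M]
    {d : ℕ} (hd : 1 ≤ d) (x : Fin d → R)
    (hx : Module.length R (M ⧸ (Ideal.span (Set.range x) • ⊤ : Submodule R M)) ≠ ⊤) :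
    (∃! e : Fin (d + 1) → ℤ, AreHilbertCoefficients (Ideal.span (Set.range x)) M e) ∧
      ∀ e : Fin (d + 1) → ℤ, AreHilbertCoefficients (Ideal.span (Set.range x)) M e →
        e ⟨1, Nat.lt_succ_of_le hd⟩ ≤ 0 := by
  obtain ⟨d, rfl⟩ := Nat.exists_eq_add_of_le' hd
  obtain ⟨l, l_antitone, hilbert_eq⟩ := exists_antitone_hilbertFunction_eq_simplexSum hx
  obtain ⟨c, c_nonneg, sum_eq⟩ := exists_eventually_simplexSum_eq_sum_multichoose l_antitone
  have are_coefficients :=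
    areHilbertCoefficients_of_eventually_eq_sum_multichoose hilbert_eq sum_eq
  refine ⟨⟨_, are_coefficients, fun e he => he.unique are_coefficients⟩, fun e he => ?_⟩
  rw [he.unique are_coefficients]
  simpa using c_nonneg

theorem mainTheorem3 {R : Type*} [CommRing R] [IsLocalRing R] [IsNoetherianRing R]
    {M : Type*} [AddCommGroup M] [Module R M] [Module.Finite R M]
    (d : ℕ) (hd : 1 ≤ d) (hdim : Module.supportDim R M = d)
    (J : Ideal R)
    (hJ : ∃ x : Fin d → R, IsSystemOfParameters M x ∧ J = Ideal.span (Set.range x)) :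
    (∃! e : Fin (d + 1) → ℤ, AreHilbertCoefficients J M e) ∧
      ∀ e : Fin (d + 1) → ℤ, AreHilbertCoefficients J M e → e ⟨1, by omega⟩ ≤ 0 := by
  obtain ⟨x, hx, rfl⟩ := hJ
  exact mainTheorem3_general hd x hx.length_ne_top
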